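/- Let $\alpha,\gamma\in\mathbb R$ and $C_0,C_1\in\mathbb C$. Let $\mathbf D=e^{i\gamma}\mathbb R$ be the line through $0$ with direction $e^{i\gamma}$, let $\mathbf P_0$ be the open half-plane bounded by $\mathbf D$ that contains $ie^{i\gamma}$, and let $\mathbf P_1=\mathbb C\setminus\mathbf P_0$. Let $T:\mathbb C\to\mathbb C$ be the piecewise rotation $$T(z)=e^{i\alpha}(z-C_j)+C_j\quad\text{if } z\in\mathbf P_j,\ j\in\{0,1\}.$$ Put $\beta=\arg(C_1-C_0)$ and $|||T|||=\sup_{z\in\mathbb C}\big||T(z)|-|z|\big|$. Call a map $T$ globally attractive if there is $M\ge 0$ such that for all $L\ge 0$, $\limsup_{n\to\infty}\sup_{|z|\le L}|T^n(z)|\le M$, and globally repulsive if there is $M\ge 0$ such that for all $L\ge M$, $\liminf_{n\to\infty}\inf_{|z|\ge L}|T^n(z)|=+\infty$. If $T$ is globally attractive or globally repulsive, let $M(T)$ be the infimum of the numbers $M\ge0$ with the respective property. Theorem. Suppose that $T$ is not bijective and that $\alpha=2\pi p/q$, where $q>2$ is an even integer, $p\in\mathbb Z$ and $\gcd(p,q)=1$.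 Then $|||T|||<\infty$, $T$ is globally attractive or globally repulsive, and $$M(T)\le q\,|||T|||\left(\frac{1}{2\,\big|\tan(\beta-\alpha/2-\gamma+\pi/2)\big|}+\frac{1}{2\tan(\pi/q)}+1\right),$$ where the first fraction is read as $0$ if $\beta-\alpha/2-\gamma\in\pi\mathbb Z$ (that is, where the tangent is infinite). -/

import Mathlib

open Filter Set
open scoped ENNReal

noncomputable section

namespace PiecewiseRotation

/-- The line `𝐃` through `z₀` with direction `e^{iγ}`. -/
def line (z₀ : ℂ) (γ : ℝ) : Set ℂ :=
  {z | ∃ t : ℝ, z = z₀ + t * Complex.exp (γ * Complex.I)}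

/-- The open half-plane `𝐏₀` bounded by `line z₀ γ` that contains `z₀ + i e^{iγ}`. -/
def halfPlane₀ (z₀ : ℂ) (γ : ℝ) : Set ℂ :=
  {z | 0 < ((z - z₀) * Complex.exp (-(γ * Complex.I))).im}

/-- The closed half-plane `𝐏₁`, the complement of `𝐏₀`. -/
def halfPlane₁ (z₀ : ℂ) (γ : ℝ) : Set ℂ := (halfPlane₀ z₀ γ)ᶜ

/-- The rotation of the plane of angle `α` about the point `C`. -/
def rot (α : ℝ) (C z : ℂ) : ℂ := Complex.exp (α * Complex.I) * (z - C) + C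

open Classical in
/-- The piecewise rotation `T`: rotation of angle `α` about `C₀` on `𝐏₀` and about `C₁` on `𝐏₁`. -/
def pieceRot (α : ℝ) (C₀ C₁ z₀ : ℂ) (γ : ℝ) (z : ℂ) : ℂ :=
  if z ∈ halfPlane₀ z₀ γ then rot α C₀ z else rot α C₁ z

/-- `|||T||| = sup { | |T z| - |z| | : z ∈ ℂ } ∈ [0, ∞]`. -/
def tripleNorm (T : ℂ → ℂ) : ℝ≥0∞ := ⨆ z : ℂ, ENNReal.ofReal |‖T z‖ - ‖z‖|

/-- `M` witnesses global attraction of `T`: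
for all `L ≥ 0`, `limsup_n sup_{|z| ≤ L} |T^n z| ≤ M`. -/
def AttractsWith (T : ℂ → ℂ) (M : ℝ) : Prop :=
  ∀ L : ℝ, 0 ≤ L →
    limsup (fun n : ℕ => ⨆ z : ℂ, ⨆ _ : ‖z‖ ≤ L, ‖T^[n] z‖ₑ) atTop ≤ ENNReal.ofReal M

/-- `M` witnesses global repulsion of `T`:
for all `L ≥ M`, `liminf_n inf_{|z| ≥ L} |T^n z| = +∞`. -/
def RepelsWith (T : ℂ → ℂ) (M : ℝ) : Prop :=
  ∀ L : ℝ, M ≤ L →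
    liminf (fun n : ℕ => ⨅ z : ℂ, ⨅ _ : L ≤ ‖z‖, ‖T^[n] z‖ₑ) atTop = ⊤

def GloballyAttractive (T : ℂ → ℂ) : Prop := ∃ M : ℝ, 0 ≤ M ∧ AttractsWith T M

def GloballyRepulsive (T : ℂ → ℂ) : Prop := ∃ M : ℝ, 0 ≤ M ∧ RepelsWith T M

/-- `M(T)`: the infimum of the `M ≥ 0` witnessing that `T` is globally attractive or globally
repulsive (no map is both). Only meaningful if `T` is one of the two. -/
def limitRadius (T : ℂ → ℂ) : ℝ :=
  sInf {M : ℝ | 0 ≤ M ∧ (AttractsWith T M ∨ RepelsWith T M)}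

end PiecewiseRotation

end

/-! Put `l = e^{iα}`, `f = (C₀ + C₁)/2`, `q = 2h`, `φ = π/q`. Then `T z` is the rotation about `f`
followed by a shift `± d`, the sign recording the half-plane of `z`. Undoing the rotation, `y n = G
l⁻ⁿ (Tⁿ z - f)` moves by kicks `± κ i μⁿ` with `μ = l⁻¹`, and the sign tells on which side of the
line `ℝ μⁿ` the point lies, up to an error `‖f‖` (`isKickOrbit_iterate`).

Since `μ` has order `2h`, the directions used in `h` consecutive kicks contain exactly one of each
pair `± ζ` of `2h`-th roots of unity. Far from the origin all of them lie on the same side of `y` up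
to a bounded error (`IsKickOrbit.block`), so their sum is known up to one ambiguous pair, and the
displacement over the block is `κ e^{± iφ} / sin φ` times a root of unity close to the direction of
`y`. Heuristically `y` moves outwards if `Re κ > 0` and inwards if `Re κ < 0`.

The Euclidean norm need not be monotone when `κ` is far from real. A gauge whose unit ball is a
suitably turned regular `2h`-gon grows by a fixed amount per block for either choice of the
ambiguous pair (`gauge_step`, `exists_lyapunov`). This gives escape if `Re κ > 0`; read backwards in
time, it gives attraction if `Re κ < 0`. If `Re κ = 0`, then `T` is bijective. The explicit radius
comes from `budget`. -/

namespace PiecewiseRotation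

/-! ### Sums and projections of half-systems of roots of unity. -/

open Complex in
/-- For a root of unity `μ` of order dividing `2h`, `μ² ≠ 1`, the projections of `b, bμ, …, bμ^{h-1}`
on a line have sum at most `‖b‖ h / √2`. -/
lemma sum_abs_im_le {h : ℕ} {μ : ℂ} (hμ : μ ^ (2 * h) = 1) (hμ2 : μ ^ 2 ≠ 1) (hn : ‖μ‖ = 1) (b : ℂ) :
    ∑ i ∈ Finset.range h, |(b * μ ^ i).im| ≤ ‖b‖ * (h / √2) := by
  have hgeo : ∑ i ∈ Finset.range h, (μ ^ 2) ^ i = 0 := by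
    have := geom_sum_mul (μ ^ 2) h
    rw [← pow_mul, hμ, sub_self, mul_eq_zero] at this
    exact this.resolve_right (sub_ne_zero.2 hμ2)
  have hsq : ∑ i ∈ Finset.range h, |(b * μ ^ i).im| ^ 2 = ‖b‖ ^ 2 * (h / 2) := by
    have h1 : ∀ w : ℂ, |w.im| ^ 2 = ‖w‖ ^ 2 / 2 - (w ^ 2).re / 2 := by
      intro w
      rw [sq_abs, ← normSq_eq_norm_sq, normSq_apply, pow_two w, mul_re]; ring
    simp_rw [h1, norm_mul, norm_pow, hn, one_pow, mul_one]
    rw [Finset.sum_sub_distrib, ← Finset.sum_div, ← Finset.sum_div, ← re_sum]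
    have : ∑ i ∈ Finset.range h, (b * μ ^ i) ^ 2 = 0 := by
      rw [← mul_zero (b ^ 2), ← hgeo, Finset.mul_sum]
      exact Finset.sum_congr rfl fun i _ => by ring
    rw [this]; simp; ring
  -- Cauchy–Schwarz costs little here: the mean square of the projections is exactly `‖b‖² / 2`.
  have hcs := sq_sum_le_card_mul_sum_sq (s := Finset.range h) (f := fun i => |(b * μ ^ i).im|)
  rw [hsq, Finset.card_range] at hcs
  refine abs_le_of_sq_le_sq' ?_ (by positivity) |>.2
  refine hcs.trans (le_of_eq ?_)
  have : (√2) ^ 2 = 2 := Real.sq_sqrt (by norm_num)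
  rw [mul_pow, div_pow, this]; ring

/-- A set containing exactly one of `ζ`, `-ζ` for every `2h`-th root of unity `ζ`. -/
def IsHalf (h : ℕ) (A : Finset ℂ) : Prop :=
  (∀ ζ ∈ A, ζ ^ (2 * h) = 1) ∧ ∀ ζ : ℂ, ζ ^ (2 * h) = 1 → (ζ ∈ A ↔ -ζ ∉ A)

open Complex in
lemma sum_Ico_exp {h : ℕ} (hh : 2 ≤ h) {φ : ℝ} (hφ : φ = Real.pi / (2 * h)) :
    ∑ m ∈ Finset.Ico 1 h, exp ((2 * φ * m : ℝ) * I) = (Real.cos φ / Real.sin φ : ℝ) * I := by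
  have h0 : (0 : ℝ) < h := by positivity
  have hs : 0 < Real.sin φ := by
    apply Real.sin_pos_of_pos_of_lt_pi
    · rw [hφ]; positivity
    · rw [hφ, div_lt_iff₀ (by positivity)]
      have : (2 : ℝ) ≤ h := by exact_mod_cast hh
      nlinarith [Real.pi_pos]
  set E := exp (φ * I) with hE
  have hEc : E = Real.cos φ + Real.sin φ * I := by rw [hE, exp_mul_I]; push_cast; rfl
  have hpow : ∀ m : ℕ, exp ((2 * φ * m : ℝ) * I) = (E ^ 2) ^ m := by
    intro m
    rw [hE, ← pow_mul, ← exp_nat_mul]; push_cast; ring_nf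
  have hlast : (E ^ 2) ^ h = -1 := by
    rw [← hpow, ← exp_pi_mul_I, hφ]; congr 3; field_simp
  simp_rw [hpow]
  have hg := geom_sum_mul (E ^ 2) h
  rw [Finset.range_eq_Ico, ← Finset.sum_Ioo_add_eq_sum_Ico (by omega)] at hg
  have hIoo : Finset.Ioo 0 h = Finset.Ico 1 h := by ext; simp; omega
  rw [hIoo, hlast, pow_zero] at hg
  have hsc : (Real.cos φ : ℂ) ^ 2 + (Real.sin φ : ℂ) ^ 2 = 1 := by
    exact_mod_cast (by rw [add_comm]; exact Real.sin_sq_add_cos_sq φ)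
  have hsne : (Real.sin φ : ℂ) ≠ 0 := by exact_mod_cast hs.ne'
  have hE0 : E ≠ 0 := exp_ne_zero _
  have hE2 : E ^ 2 - 1 = 2 * Real.sin φ * I * E := by
    rw [hEc]; linear_combination hsc + (-Real.sin φ ^ 2 : ℂ) * I_sq
  have hE3 : E ^ 2 + 1 = 2 * Real.cos φ * E := by
    rw [hEc]; linear_combination (-1) * hsc + (Real.sin φ ^ 2 : ℂ) * I_sq
  have hne : E ^ 2 - 1 ≠ 0 := by
    rw [hE2]; exact mul_ne_zero (mul_ne_zero (mul_ne_zero two_ne_zero hsne) I_ne_zero) hE0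
  apply mul_right_cancel₀ hne
  have : (∑ m ∈ Finset.Ico 1 h, (E ^ 2) ^ m) * (E ^ 2 - 1) = -(E ^ 2 + 1) := by
    linear_combination hg
  rw [this, hE2, hE3, ofReal_div]
  field_simp
  rw [I_sq]; ring

/-- A point `X + iW` of the sector of half-angle `φ` is clearly on the wrong side of the `m`-th
direction. The worst cases are the two edges of the sector, where the angles `τ ∓ φ` stay in `[e, π
- e]`; the upper end uses `e ≤ φ`. -/
lemma cone_lower_bound {h m : ℕ} {φ e X W : ℝ} (hφ : φ = Real.pi / (2 * h)) (hh : 2 ≤ h)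
    (he0 : 0 < e) (heφ : e ≤ φ) (hW : |W| * Real.cos φ ≤ X * Real.sin φ)
    (hm1 : 1 ≤ m) (hm : m < h) (hX : 0 ≤ X) :
    X * Real.sin e ≤ Real.cos φ *
      (X * Real.sin (2 * φ * m + e - φ) - W * Real.cos (2 * φ * m + e - φ)) := by
  have h0 : (0 : ℝ) < h := by positivity
  have hφh : 2 * φ * h = Real.pi := by rw [hφ]; field_simp
  have hφ0 : 0 < φ := he0.trans_le heφ
  have m1 : (1 : ℝ) ≤ m := by exact_mod_cast hm1
  have m2 : (m : ℝ) + 1 ≤ h := by exact_mod_cast hm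
  have hsin : ∀ x, e ≤ x → x ≤ Real.pi - e → Real.sin e ≤ Real.sin x := by
    intro x h1 h2
    have e2 : e ≤ Real.pi / 2 := by linarith
    rcases le_total x (Real.pi / 2) with h3 | h3
    · exact Real.sin_le_sin_of_le_of_le_pi_div_two (by linarith) h3 h1
    · rw [← Real.sin_pi_sub x]
      exact Real.sin_le_sin_of_le_of_le_pi_div_two (by linarith) (by linarith) (by linarith)
  set τ := 2 * φ * m + e - φ with hτ
  have b1 : 2 * φ ≤ 2 * φ * m := by nlinarith
  have b2 : 2 * φ * m + 2 * φ ≤ Real.pi := by nlinarith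
  have s1 := hsin (τ - φ) (by linarith) (by linarith)
  have s2 := hsin (τ + φ) (by linarith) (by linarith)
  rw [Real.sin_sub] at s1
  rw [Real.sin_add] at s2
  have hWc : W * Real.cos φ * Real.cos τ ≤ X * Real.sin φ * |Real.cos τ| := by
    calc _ ≤ |W * Real.cos φ * Real.cos τ| := le_abs_self _
      _ = |W| * |Real.cos φ| * |Real.cos τ| := by rw [abs_mul, abs_mul]
      _ ≤ _ := by
        have : 0 ≤ Real.cos φ := Real.cos_nonneg_of_neg_pi_div_two_le_of_le (by linarith) (by
          have : (2:ℝ) ≤ h := by exact_mod_cast hh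
          nlinarith)
        rw [abs_of_nonneg this]
        exact mul_le_mul_of_nonneg_right hW (abs_nonneg _)
  rcases le_total 0 (Real.cos τ) with hc | hc
  · rw [abs_of_nonneg hc] at hWc; nlinarith
  · rw [abs_of_nonpos hc] at hWc; nlinarith

/-! ### The polygonal gauge. -/

open Complex in
/-- The value at `y` of the linear functional with direction `D ζ`. -/
noncomputable def functional (D y ζ : ℂ) : ℝ := (y * (starRingEnd ℂ) (D * ζ)).re

lemma one_mem_nthRoots {h : ℕ} (hh : 2 ≤ h) :
    (1 : ℂ) ∈ Polynomial.nthRootsFinset (2 * h) (1 : ℂ) :=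
  Polynomial.one_mem_nthRootsFinset (by omega)

/-- The gauge of the regular `2h`-gon with sides orthogonal to the directions `D ζ`. -/
noncomputable def polygonGauge (h : ℕ) (hh : 2 ≤ h) (D y : ℂ) : ℝ :=
  (Polynomial.nthRootsFinset (2 * h) (1 : ℂ)).sup' ⟨1, one_mem_nthRoots hh⟩ (functional D y)

lemma polygonGauge_le {h : ℕ} (hh : 2 ≤ h) {D : ℂ} (hD : ‖D‖ = 1) (y : ℂ) :
    polygonGauge h hh D y ≤ ‖y‖ := by
  refine Finset.sup'_le _ _ fun ζ hζ => ?_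
  have h1 : ζ ^ (2 * h) = 1 := (Polynomial.mem_nthRootsFinset (by omega) 1).1 hζ
  have h2 : ‖ζ‖ = 1 := Complex.norm_eq_one_of_pow_eq_one h1 (by omega)
  refine (Complex.re_le_norm _).trans ?_
  simp [hD, h2]

lemma functional_le_gauge {h : ℕ} (hh : 2 ≤ h) (D y ζ : ℂ) (hζ : ζ ^ (2 * h) = 1) :
    functional D y ζ ≤ polygonGauge h hh D y :=
  Finset.le_sup' (functional D y) ((Polynomial.mem_nthRootsFinset (by omega) 1).2 hζ)

open Complex in
lemma exp_pow_eq_one {h : ℕ} (hh : 2 ≤ h) {φ : ℝ} (hφ : φ = Real.pi / (2 * h)) (j : ℤ) :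
    exp ((2 * φ * j : ℝ) * I) ^ (2 * h) = 1 := by
  have h0 : (h : ℂ) ≠ 0 := by simp; omega
  rw [← exp_nat_mul, exp_eq_one_iff]
  refine ⟨j, ?_⟩
  rw [hφ]; push_cast; field_simp

open Complex in
lemma cos_mul_norm_le_gauge {h : ℕ} (hh : 2 ≤ h) {φ κ : ℝ} (hφ : φ = Real.pi / (2 * h)) (y : ℂ) :
    Real.cos φ * ‖y‖ ≤ polygonGauge h hh (exp (κ * I)) y := by
  have h0 : (0 : ℝ) < h := by positivity
  have hφ0 : 0 < φ := by rw [hφ]; positivity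
  -- The index of the direction nearest to `y`; it is within angle `φ`.
  set j : ℤ := round ((y.arg - κ) / (2 * φ))
  refine le_trans ?_ (functional_le_gauge hh _ y _ (exp_pow_eq_one hh hφ j))
  have hj := abs_sub_round ((y.arg - κ) / (2 * φ))
  have hx : |y.arg - κ - 2 * φ * j| ≤ φ := by
    have : y.arg - κ - 2 * φ * j = 2 * φ * ((y.arg - κ) / (2 * φ) - j) := by field_simp
    rw [this, abs_mul, abs_of_pos (by positivity : 0 < 2 * φ)]
    nlinarith
  have hcos : Real.cos φ ≤ Real.cos (y.arg - κ - 2 * φ * j) := by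
    rw [← Real.cos_abs (y.arg - κ - 2 * φ * j)]
    refine Real.cos_le_cos_of_nonneg_of_le_pi (abs_nonneg _) ?_ hx
    rw [hφ]; apply div_le_self Real.pi_pos.le
    have : (2 : ℝ) ≤ h := by exact_mod_cast hh
    linarith
  have : functional (exp (κ * I)) y (exp ((2 * φ * j : ℝ) * I))
      = ‖y‖ * Real.cos (y.arg - κ - 2 * φ * j) := by
    unfold functional
    rw [← exp_add, ← exp_conj]
    nth_rewrite 1 [← norm_mul_exp_arg_mul_I y]
    rw [mul_assoc, ← exp_add, re_ofReal_mul, ← exp_ofReal_mul_I_re]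
    congr 3
    simp [conj_ofNat]; ring
  rw [this, mul_comm]
  exact mul_le_mul_of_nonneg_left hcos (norm_nonneg _)


/-! ### Growth of the gauge along a half-system. -/

-- Excluding `h - 1` consecutive roots after `ζ₀` forces their antipodes into `A`, and only the
-- choice between `ζ₀` and `-ζ₀` remains: this is the sign `σ`.
open Complex in
lemma IsHalf.sum_eq {h : ℕ} {A : Finset ℂ} (hA : IsHalf h A) (hh : 2 ≤ h) {φ : ℝ}
    (hφ : φ = Real.pi / (2 * h)) {ζ₀ : ℂ} (hζ₀ : ζ₀ ^ (2 * h) = 1)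
    (hnot : ∀ m : ℕ, 1 ≤ m → m < h → ζ₀ * exp ((2 * φ * m : ℝ) * I) ∉ A) :
    ∃ σ : ℝ, (σ = 1 ∨ σ = -1) ∧
      ∑ ζ ∈ A, ζ = ζ₀ * (σ - (Real.cos φ / Real.sin φ : ℝ) * I) := by
  have h0 : (0 : ℝ) < h := by positivity
  have h0c : (h : ℂ) ≠ 0 := by exact_mod_cast h0.ne'
  have hz : ζ₀ ≠ 0 := by rintro rfl; rw [zero_pow (by omega)] at hζ₀; exact zero_ne_one hζ₀
  set ω := exp (2 * Real.pi * I / ((2 * h : ℕ) : ℂ)) with hω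
  have hprim : IsPrimitiveRoot ω (2 * h) := isPrimitiveRoot_exp _ (by omega)
  have hpow : ∀ m : ℕ, exp ((2 * φ * m : ℝ) * I) = ω ^ m := by
    intro m
    rw [hω, ← exp_nat_mul, hφ]; congr 1; push_cast; field_simp
  have hωh : ω ^ h = -1 := by
    rw [← hpow, ← exp_pi_mul_I, hφ]; congr 3; field_simp
  have hroot : ∀ m : ℕ, (ζ₀ * ω ^ m) ^ (2 * h) = 1 := by
    intro m; rw [mul_pow, hζ₀, ← pow_mul, mul_comm m, pow_mul, hprim.pow_eq_one]; simp
  have hsum := sum_Ico_exp hh hφ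
  simp_rw [hpow] at hsum hnot
  have hmem : ∀ m : ℕ, 1 ≤ m → m < h → -(ζ₀ * ω ^ m) ∈ A := by
    intro m h1 h2
    by_contra hc
    exact hnot m h1 h2 ((hA.2 _ (hroot m)).2 hc)
  have key : ∀ σ : ℂ, (σ = 1 ∨ σ = -1) → σ * ζ₀ ∈ A →
      ∑ ζ ∈ A, ζ = ζ₀ * (σ - (Real.cos φ / Real.sin φ : ℝ) * I) := by
    intro σ hσ hσA
    have hinj : Set.InjOn (fun m : ℕ => -(ζ₀ * ω ^ m)) (Finset.Ico 1 h : Set ℕ) := by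
      intro a ha b hb hab
      simp only [Finset.coe_Ico, Set.mem_Ico] at ha hb
      have : ω ^ a = ω ^ b := mul_left_cancel₀ hz (neg_inj.1 hab)
      exact hprim.pow_inj (by omega) (by omega) this
    have hAeq : A = insert (σ * ζ₀) ((Finset.Ico 1 h).image (fun m : ℕ => -(ζ₀ * ω ^ m))) := by
      ext ζ
      simp only [Finset.mem_insert, Finset.mem_image, Finset.mem_Ico]
      constructor
      · intro hζ
        have hζ1 := hA.1 ζ hζ
        have : NeZero (2 * h) := ⟨by omega⟩
        obtain ⟨k, hk, hk2⟩ := hprim.eq_pow_of_pow_eq_one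
          (show (ζ / ζ₀) ^ (2 * h) = 1 by rw [div_pow, hζ1, hζ₀, div_one])
        have hζk : ζ = ζ₀ * ω ^ k := by rw [hk2]; field_simp
        have hσ0 : k = 0 ∨ k = h → ζ = σ * ζ₀ := by
          intro hk0
          have h3 : ζ = ζ₀ ∨ ζ = -ζ₀ := by
            rcases hk0 with rfl | rfl
            · left; simpa using hζk
            · right; rw [hζk, hωh]; ring
          have h4 := (hA.2 ζ₀ hζ₀)
          rcases h3 with rfl | rfl <;> rcases hσ with rfl | rfl
          · ring
          · exact absurd (by simpa using hσA) (h4.1 hζ)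
          · exact absurd hζ (h4.1 (by simpa using hσA))
          · ring
        rcases Nat.lt_or_ge k h with hkh | hkh
        · rcases Nat.eq_zero_or_pos k with hk0 | hk0
          · exact Or.inl (hσ0 (Or.inl hk0))
          · exact absurd (hζk ▸ hζ) (hnot k hk0 hkh)
        · rcases Nat.eq_or_lt_of_le hkh with hk0 | hk0
          · exact Or.inl (hσ0 (Or.inr hk0.symm))
          · refine Or.inr ⟨k - h, by omega, ?_⟩
            obtain ⟨l, rfl⟩ := Nat.exists_eq_add_of_le hkh
            rw [hζk, Nat.add_sub_cancel_left, pow_add, hωh]; ring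
      · rintro (rfl | ⟨m, ⟨h1, h2⟩, rfl⟩)
        · exact hσA
        · exact hmem m h1 h2
    have hnin : σ * ζ₀ ∉ (Finset.Ico 1 h).image (fun m : ℕ => -(ζ₀ * ω ^ m)) := by
      simp only [Finset.mem_image, Finset.mem_Ico, not_exists, not_and]
      intro m hm heq
      have h5 : ω ^ m = -σ := by
        apply mul_left_cancel₀ hz; linear_combination -heq
      have h6 : ω ^ (2 * m) = 1 := by
        rw [mul_comm, pow_mul, h5]; rcases hσ with rfl | rfl <;> norm_num
      have := Nat.le_of_dvd (by omega) (hprim.dvd_of_pow_eq_one _ h6)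
      omega
    rw [hAeq, Finset.sum_insert hnin, Finset.sum_image hinj, Finset.sum_neg_distrib,
      ← Finset.mul_sum, hsum]
    ring
  by_cases hc : ζ₀ ∈ A
  · exact ⟨1, Or.inl rfl, by simpa using key 1 (Or.inl rfl) (by simpa using hc)⟩
  · have : -ζ₀ ∈ A := by
      by_contra hc2; exact hc ((hA.2 _ hζ₀).2 hc2)
    exact ⟨-1, Or.inr rfl, by simpa using key (-1) (Or.inr rfl) (by simpa using this)⟩

-- Let `D ζ₀` be the direction attaining the gauge. Maximality against its two neighbours puts `y`
-- in a sector of half-angle `φ`, where `cone_lower_bound` leaves only `± ζ₀` undecided. The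
-- displacement is then `κ ζ₀ e^{± iφ} / sin φ`, and the two terms of the minimum are its components
-- along `D ζ₀`.
open Complex in
lemma gauge_step {h : ℕ} (hh : 2 ≤ h) {φ e ε : ℝ} (hφ : φ = Real.pi / (2 * h))
    (he0 : 0 < e) (heφ : e ≤ φ) {A : Finset ℂ} (hA : IsHalf h A) {y : ℂ}
    (hy : ∀ ζ ∈ A, -ε ≤ (y * (starRingEnd ℂ) ζ).im) {D : ℂ} (hD : D = exp ((φ - e : ℝ) * I))
    (hbig : ε * Real.cos φ < polygonGauge h hh D y * Real.sin e) (κ : ℂ) :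
    polygonGauge h hh D y + min (κ.re * Real.cos e - κ.im * Real.sin e)
      (κ.re * Real.cos (2 * φ - e) + κ.im * Real.sin (2 * φ - e)) / Real.sin φ
      ≤ polygonGauge h hh D (y + κ * I * ∑ ζ ∈ A, ζ) := by
  have h0 : (0 : ℝ) < h := by positivity
  have h2 : (2 : ℝ) ≤ h := by exact_mod_cast hh
  have hφ0 : 0 < φ := he0.trans_le heφ
  have hφh : 2 * φ * h = Real.pi := by rw [hφ]; field_simp
  have hφ4 : 2 * φ ≤ Real.pi / 2 := by nlinarith
  have hcφ : 0 < Real.cos φ := Real.cos_pos_of_mem_Ioo ⟨by linarith, by linarith⟩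
  have hsφ : 0 < Real.sin φ := Real.sin_pos_of_pos_of_lt_pi hφ0 (by linarith)
  have hse : 0 < Real.sin e := Real.sin_pos_of_pos_of_lt_pi he0 (by linarith)
  obtain ⟨ζ₀, hmem, hmax⟩ := Finset.exists_mem_eq_sup' ⟨1, one_mem_nthRoots hh⟩ (functional D y)
  have hζ₀ : ζ₀ ^ (2 * h) = 1 := (Polynomial.mem_nthRootsFinset (by omega) 1).1 hmem
  have hnζ : ‖ζ₀‖ = 1 := norm_eq_one_of_pow_eq_one hζ₀ (by omega)
  have hζζ : ζ₀ * (starRingEnd ℂ) ζ₀ = 1 := by rw [mul_conj, normSq_eq_norm_sq, hnζ]; simp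
  have hDD : D * (starRingEnd ℂ) D = 1 := by
    rw [mul_conj, normSq_eq_norm_sq, hD, norm_exp_ofReal_mul_I]; simp
  set Y := y * (starRingEnd ℂ) (D * ζ₀) with hY
  have hgX : polygonGauge h hh D y = Y.re := hmax
  -- the neighbouring functionals are not larger
  have hnb : ∀ j : ℤ, Y.re * Real.cos (2 * φ * j) + Y.im * Real.sin (2 * φ * j) ≤ Y.re := by
    intro j
    refine le_trans (le_of_eq ?_)
      ((functional_le_gauge hh D y (ζ₀ * exp ((2 * φ * j : ℝ) * I)) ?_).trans hgX.le)
    · have : functional D y (ζ₀ * exp ((2 * φ * j : ℝ) * I))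
          = (Y * (starRingEnd ℂ) (exp ((2 * φ * j : ℝ) * I))).re := by
        unfold functional; rw [hY]; congr 1; simp only [map_mul]; ring
      rw [this, mul_re Y, conj_re, conj_im, exp_ofReal_mul_I_re, exp_ofReal_mul_I_im]; ring
    · rw [mul_pow, hζ₀, exp_pow_eq_one hh hφ]; simp
  have hW : |Y.im| * Real.cos φ ≤ Y.re * Real.sin φ := by
    have n1 := hnb 1
    have n2 := hnb (-1)
    simp only [Int.cast_neg, Int.cast_one, mul_neg, mul_one, Real.cos_neg, Real.sin_neg] at n1 n2
    rw [Real.cos_two_mul, Real.sin_two_mul] at n1 n2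
    have : |Y.im| * (2 * Real.sin φ * Real.cos φ) ≤ Y.re * (2 * Real.sin φ ^ 2) := by
      rw [Real.sin_sq]
      rcases abs_cases Y.im with ⟨h', _⟩ | ⟨h', _⟩ <;> rw [h'] <;> linarith
    have h3 : 0 < 2 * Real.sin φ := by positivity
    nlinarith
  have hX : 0 ≤ Y.re := by
    have := mul_nonneg (abs_nonneg Y.im) hcφ.le
    by_contra hc; push Not at hc; nlinarith
  have hnot : ∀ m : ℕ, 1 ≤ m → m < h → ζ₀ * exp ((2 * φ * m : ℝ) * I) ∉ A := by
    intro m m1 m2 hmA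
    have h4 := hy _ hmA
    have h5 : y * (starRingEnd ℂ) (ζ₀ * exp ((2 * φ * m : ℝ) * I))
        = Y * exp ((-(2 * φ * m + e - φ) : ℝ) * I) := by
      have h6 : (starRingEnd ℂ) (exp ((2 * φ * m : ℝ) * I)) = exp ((-(2 * φ * m) : ℝ) * I) := by
        rw [← exp_conj]; congr 1; rw [map_mul, conj_ofReal, conj_I]; push_cast; ring
      have h7 : exp ((-(2 * φ * m + e - φ) : ℝ) * I) = D * exp ((-(2 * φ * m) : ℝ) * I) := by
        rw [hD, ← exp_add]; congr 1; push_cast; ring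
      rw [h7, hY, map_mul, map_mul, h6]
      linear_combination (-y * (starRingEnd ℂ) ζ₀ * exp ((-(2 * φ * m) : ℝ) * I)) * hDD
    rw [h5, mul_im, exp_ofReal_mul_I_re, exp_ofReal_mul_I_im, Real.cos_neg, Real.sin_neg] at h4
    have h8 := cone_lower_bound hφ hh he0 heφ hW m1 m2 hX
    rw [hgX] at hbig
    nlinarith
  obtain ⟨σ, hσ, hsum⟩ := hA.sum_eq hh hφ hζ₀ hnot
  refine le_trans ?_ (functional_le_gauge hh D _ ζ₀ hζ₀)
  have hfun : functional D (y + κ * I * ∑ ζ ∈ A, ζ) ζ₀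
      = Y.re + (κ * (starRingEnd ℂ) D * (σ * I + (Real.cos φ / Real.sin φ : ℝ))).re := by
    unfold functional
    rw [← add_re, hsum, hY, map_mul]
    congr 1
    linear_combination (κ * (starRingEnd ℂ) D * (σ * I - (Real.cos φ / Real.sin φ : ℝ) * I ^ 2))
      * hζζ - (κ * (starRingEnd ℂ) D * (Real.cos φ / Real.sin φ : ℝ)) * I_sq
  rw [hfun, hgX]
  gcongr
  have hDc : D = Real.cos (φ - e) + Real.sin (φ - e) * I := by
    rw [hD, exp_mul_I]; push_cast; rfl
  have hval : (κ * (starRingEnd ℂ) D * (σ * I + (Real.cos φ / Real.sin φ : ℝ))).re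
      = (κ.re * (Real.cos φ * Real.cos (φ - e) + σ * (Real.sin φ * Real.sin (φ - e)))
        + κ.im * (Real.cos φ * Real.sin (φ - e) - σ * (Real.sin φ * Real.cos (φ - e))))
        / Real.sin φ := by
    rw [hDc]
    simp only [mul_re, mul_im, add_re, add_im, map_add, map_mul, conj_ofReal, conj_I, ofReal_re,
      ofReal_im, I_re, I_im, neg_re, neg_im]
    field_simp
    ring
  rw [hval]
  gcongr
  rcases hσ with rfl | rfl
  · refine (min_le_left _ _).trans (le_of_eq ?_)
    rw [show e = φ - (φ - e) by ring, Real.cos_sub φ (φ - e), Real.sin_sub φ (φ - e)]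
    rw [show φ - (φ - (φ - e)) = φ - e by ring]; ring
  · refine (min_le_right _ _).trans (le_of_eq ?_)
    rw [show 2 * φ - e = φ + (φ - e) by ring, Real.cos_add, Real.sin_add]; ring

/-- A polygonal gauge growing along the displacements `κ i ∑ A`. -/
lemma exists_lyapunov_of_im_nonneg {h : ℕ} (hh : 2 ≤ h) {φ ε : ℝ} (hφ : φ = Real.pi / (2 * h))
    (hε : 0 ≤ ε) {κ : ℂ} (hκ : 0 < κ.re) (hκ2 : 0 ≤ κ.im) :
    ∃ (N : ℂ → ℝ) (η : ℝ), 0 < η ∧ (∀ y, Real.cos φ * ‖y‖ ≤ N y ∧ N y ≤ ‖y‖) ∧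
      ∀ (A : Finset ℂ) (y : ℂ), IsHalf h A →
        (∀ ζ ∈ A, -ε ≤ (y * (starRingEnd ℂ) ζ).im) →
        ε * Real.cos φ * (1 + |κ.im / κ.re| + Real.cos φ / Real.sin φ) < N y →
        N y + η ≤ N (y + κ * Complex.I * ∑ ζ ∈ A, ζ) := by
  have h0 : (0 : ℝ) < h := by positivity
  have h2 : (2 : ℝ) ≤ h := by exact_mod_cast hh
  have hφ0 : 0 < φ := by rw [hφ]; positivity
  have hφh : 2 * φ * h = Real.pi := by rw [hφ]; field_simp
  have hφ4 : 2 * φ ≤ Real.pi / 2 := by nlinarith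
  have hcφ : 0 < Real.cos φ := Real.cos_pos_of_mem_Ioo ⟨by linarith, by linarith⟩
  have hsφ : 0 < Real.sin φ := Real.sin_pos_of_pos_of_lt_pi hφ0 (by linarith)
  set t := |κ.im / κ.re| with ht
  have ht' : t * κ.re = κ.im := by
    rw [ht, abs_of_nonneg (by positivity)]; field_simp
  have ht0 : 0 ≤ t := abs_nonneg _
  set c := t + Real.cos φ / Real.sin φ with hc
  have hc0 : 0 < c := by positivity
  -- The tilt of the polygon: `cot e = |Im κ / Re κ| + cot φ` makes the gain for `σ = 1` equal to
  -- `Re κ · cot φ · sin e > 0` (before division by `sin φ`), and forces `e ≤ φ`.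
  set e := Real.arctan c⁻¹ with he
  have he0 : 0 < e := Real.arctan_pos.2 (by positivity)
  have heπ : e < Real.pi / 2 := Real.arctan_lt_pi_div_two _
  have heφ : e ≤ φ := by
    rw [← Real.arctan_tan (x := φ) (by linarith) (by linarith)]
    apply Real.arctan_mono
    rw [Real.tan_eq_sin_div_cos, ← inv_div]
    gcongr
    rw [hc]; linarith
  have hse : 0 < Real.sin e := Real.sin_pos_of_pos_of_lt_pi he0 (by linarith)
  have hce : 0 < Real.cos e := Real.cos_pos_of_mem_Ioo ⟨by linarith, heπ⟩
  have hcot : Real.cos e = c * Real.sin e := by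
    have : Real.sin e / Real.cos e = c⁻¹ := by
      rw [← Real.tan_eq_sin_div_cos, he, Real.tan_arctan]
    field_simp at this
    linarith
  have g1 : 0 < κ.re * Real.cos e - κ.im * Real.sin e := by
    have : κ.re * Real.cos e - κ.im * Real.sin e
        = κ.re * (Real.cos φ / Real.sin φ) * Real.sin e := by rw [hcot, hc, ← ht']; ring
    rw [this]; positivity
  have g2 : 0 < κ.re * Real.cos (2 * φ - e) + κ.im * Real.sin (2 * φ - e) := by
    have a1 : 0 < Real.cos (2 * φ - e) :=
      Real.cos_pos_of_mem_Ioo ⟨by linarith, by linarith⟩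
    have a2 : 0 ≤ Real.sin (2 * φ - e) :=
      Real.sin_nonneg_of_nonneg_of_le_pi (by linarith) (by linarith)
    positivity
  refine ⟨polygonGauge h hh (Complex.exp ((φ - e : ℝ) * Complex.I)), _,
    div_pos (lt_min g1 g2) hsφ,
    fun y => ⟨cos_mul_norm_le_gauge hh hφ y,
      polygonGauge_le hh (Complex.norm_exp_ofReal_mul_I _) y⟩, ?_⟩
  intro A y hA hy hbig
  refine gauge_step hh hφ he0 heφ hA hy rfl ?_ κ
  -- `(1 + c) sin e = sin e + cos e ≥ 1`, so the threshold can be stated without `e`.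
  have k1 : 1 ≤ (1 + c) * Real.sin e := by
    have : 1 ≤ Real.sin e + Real.cos e := by
      have := Real.sin_sq_add_cos_sq e
      nlinarith
    linarith
  have k2 : ε * Real.cos φ * 1 ≤ ε * Real.cos φ * ((1 + c) * Real.sin e) := by gcongr
  have k3 := mul_lt_mul_of_pos_right hbig hse
  rw [hc] at k2
  linarith

lemma exists_lyapunov {h : ℕ} (hh : 2 ≤ h) {φ ε : ℝ} (hφ : φ = Real.pi / (2 * h))
    (hε : 0 ≤ ε) {κ : ℂ} (hκ : 0 < κ.re) :
    ∃ (N : ℂ → ℝ) (η : ℝ), 0 < η ∧ (∀ y, Real.cos φ * ‖y‖ ≤ N y ∧ N y ≤ ‖y‖) ∧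
      ∀ (A : Finset ℂ) (y : ℂ), IsHalf h A →
        (∀ ζ ∈ A, -ε ≤ (y * (starRingEnd ℂ) ζ).im) →
        ε * Real.cos φ * (1 + |κ.im / κ.re| + Real.cos φ / Real.sin φ) < N y →
        N y + η ≤ N (y + κ * Complex.I * ∑ ζ ∈ A, ζ) := by
  rcases le_total 0 κ.im with hκ2 | hκ2
  · exact exists_lyapunov_of_im_nonneg hh hφ hε hκ hκ2
  obtain ⟨N, η, hη, hN, hstep⟩ := exists_lyapunov_of_im_nonneg (κ := (starRingEnd ℂ) κ) hh hφ hε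
    (by simpa using hκ) (by simpa using hκ2)
  refine ⟨fun y => N ((starRingEnd ℂ) y), η, hη, fun y => by simpa using hN ((starRingEnd ℂ) y), ?_⟩
  intro A y hA hy hbig
  -- Conjugation turns `κ i ζ` into `conj κ · i · (-conj ζ)`; the sign also preserves the side
  -- condition.
  have hinj : Function.Injective (fun ζ : ℂ => -(starRingEnd ℂ) ζ) :=
    fun a b hab => (starRingEnd ℂ).injective (neg_injective hab)
  have hA' : IsHalf h (A.image fun ζ : ℂ => -(starRingEnd ℂ) ζ) := by
    have hmem : ∀ ζ : ℂ, ζ ∈ A.image (fun ζ : ℂ => -(starRingEnd ℂ) ζ) ↔ -(starRingEnd ℂ) ζ ∈ A := by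
      intro ζ
      rw [Finset.mem_image]
      constructor
      · rintro ⟨a, ha, rfl⟩; simpa using ha
      · intro hζ; exact ⟨_, hζ, by simp⟩
    have hroot : ∀ ζ : ℂ, (-(starRingEnd ℂ) ζ) ^ (2 * h) = 1 ↔ ζ ^ (2 * h) = 1 := by
      intro ζ
      rw [Even.neg_pow (even_two_mul h), ← map_pow]
      exact map_eq_one_iff _ (starRingEnd ℂ).injective
    refine ⟨fun ζ hζ => (hroot ζ).1 (hA.1 _ ((hmem ζ).1 hζ)), fun ζ hζ => ?_⟩
    rw [hmem, hmem, hA.2 _ ((hroot ζ).2 hζ), map_neg]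
  have := hstep _ ((starRingEnd ℂ) y) hA' ?_ ?_
  · refine this.trans (le_of_eq ?_)
    rw [Finset.sum_image hinj.injOn]
    congr 1
    simp [map_sum, Finset.mul_sum]
  · intro ζ hζ
    obtain ⟨a, ha, rfl⟩ := Finset.mem_image.1 hζ
    have := hy a ha
    simp at this ⊢
    linarith
  · simpa [neg_div, abs_neg] using hbig


/-! ### Kick orbits: blocks of `h` steps, escape and attraction. -/

/-- Sequences moved at time `n` by `± a μ ^ n`, the sign agreeing up to the tolerance `δ` with the
side of the line `ℝ μ ^ n` on which the point lies. -/
def IsKickOrbit (μ a : ℂ) (δ : ℝ) (y : ℕ → ℂ) : Prop :=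
  ∃ s : ℕ → ℝ, (∀ n, s n = 1 ∨ s n = -1) ∧ (∀ n, y (n + 1) = y n + a * (s n * μ ^ n)) ∧
    ∀ n, -δ ≤ (y n * (starRingEnd ℂ) (s n * μ ^ n)).im

/-- Squaring forgets the signs, and the squares `(μ²)^(n+k)` run once through the `h`-th roots of
unity. -/
lemma isHalf_image {h : ℕ} (hh : 2 ≤ h) {μ : ℂ} (hμ : IsPrimitiveRoot μ (2 * h)) {s : ℕ → ℝ}
    (hs : ∀ n, s n = 1 ∨ s n = -1) (n : ℕ) :
    Set.InjOn (fun k => (s (n + k) : ℂ) * μ ^ (n + k)) (Finset.range h) ∧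
      IsHalf h ((Finset.range h).image fun k => (s (n + k) : ℂ) * μ ^ (n + k)) := by
  have hμ2 : IsPrimitiveRoot (μ ^ 2) h := hμ.pow (by omega) rfl
  have hμ0 : μ ≠ 0 := hμ.ne_zero (by omega)
  have hs2 : ∀ k, (s k : ℂ) ^ 2 = 1 := by
    intro k; rcases hs k with h1 | h1 <;> rw [h1] <;> norm_num
  have hsq : ∀ k, ((s k : ℂ) * μ ^ k) ^ 2 = (μ ^ 2) ^ k := by
    intro k; rw [mul_pow, hs2, one_mul, ← pow_mul, ← pow_mul, mul_comm]
  have hinj2 : ∀ i < h, ∀ k < h, (μ ^ 2) ^ (n + i) = (μ ^ 2) ^ (n + k) → i = k := by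
    intro i hi k hk hik
    rw [pow_add, pow_add] at hik
    exact hμ2.pow_inj hi hk (mul_left_cancel₀ (pow_ne_zero _ (pow_ne_zero _ hμ0)) hik)
  have hroot : ∀ k, ((s k : ℂ) * μ ^ k) ^ (2 * h) = 1 := by
    intro k
    rw [pow_mul, hsq, ← pow_mul, mul_comm, pow_mul, hμ2.pow_eq_one, one_pow]
  refine ⟨?_, ?_, ?_⟩
  · intro i hi k hk hik
    simp only [Finset.coe_range, Set.mem_Iio] at hi hk
    refine hinj2 i hi k hk ?_
    rw [← hsq, ← hsq]
    exact congrArg (· ^ 2) hik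
  · intro ζ hζ
    obtain ⟨k, -, rfl⟩ := Finset.mem_image.1 hζ
    exact hroot _
  · intro ζ hζ
    simp only [Finset.mem_image, Finset.mem_range]
    constructor
    · rintro ⟨i, hi, rfl⟩ ⟨k, hk, hik⟩
      have : i = k := by
        refine hinj2 i hi k hk ?_
        rw [← hsq, ← hsq, hik, neg_sq]
      subst this
      have h0 : (s (n + i) : ℂ) * μ ^ (n + i) = 0 := by linear_combination hik / 2
      have := hroot (n + i)
      rw [h0, zero_pow (by omega)] at this
      exact zero_ne_one this
    · intro hne
      by_contra hc
      have h1 : ((ζ / μ ^ n) ^ 2) ^ h = 1 := by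
        rw [← pow_mul, div_pow, hζ, ← pow_mul, mul_comm n, pow_mul, hμ.pow_eq_one]; simp
      have : NeZero h := ⟨by omega⟩
      obtain ⟨k, hk, hk2⟩ := hμ2.eq_pow_of_pow_eq_one h1
      have h2 : ζ ^ 2 = ((s (n + k) : ℂ) * μ ^ (n + k)) ^ 2 := by
        rw [hsq, pow_add, hk2]; field_simp; ring
      rcases sq_eq_sq_iff_eq_or_eq_neg.1 h2 with h3 | h3
      · exact hc ⟨k, hk, h3.symm⟩
      · exact hne ⟨k, hk, by rw [h3, neg_neg]⟩

lemma IsKickOrbit.add_sum {μ a : ℂ} {y : ℕ → ℂ} {s : ℕ → ℝ}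
    (hy : ∀ n, y (n + 1) = y n + a * (s n * μ ^ n)) (n k : ℕ) :
    y (n + k) = y n + a * ∑ i ∈ Finset.range k, (s (n + i) : ℂ) * μ ^ (n + i) := by
  induction k with
  | zero => simp
  | succ k ih => rw [← add_assoc, hy, ih, Finset.sum_range_succ]; ring

/-- The side condition for the `k`-th kick holds at time `n + k`; `sum_abs_im_le` carries it to both
ends of the block. The start serves escape, the end serves attraction. -/
lemma IsKickOrbit.block {h : ℕ} (hh : 2 ≤ h) {μ a : ℂ} (hμ : IsPrimitiveRoot μ (2 * h)) {δ : ℝ}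
    {y : ℕ → ℂ} (hy : IsKickOrbit μ a δ y) (n : ℕ) :
    ∃ A : Finset ℂ, IsHalf h A ∧ y (n + h) = y n + a * ∑ ζ ∈ A, ζ ∧
      ∀ ζ ∈ A, -(δ + ‖a‖ * (h / √2)) ≤ (y n * (starRingEnd ℂ) ζ).im ∧
        -(δ + ‖a‖ * (h / √2)) ≤ (y (n + h) * (starRingEnd ℂ) ζ).im := by
  obtain ⟨s, hs, hstep, hside⟩ := hy
  obtain ⟨hinj, hhalf⟩ := isHalf_image hh hμ hs n
  have hnμ : ‖μ‖ = 1 := Complex.norm_eq_one_of_pow_eq_one hμ.pow_eq_one (by omega)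
  have hμ2 : μ ^ 2 ≠ 1 := fun h1 => by
    have := Nat.le_of_dvd (by omega) (hμ.dvd_of_pow_eq_one _ h1); omega
  refine ⟨_, hhalf, by rw [Finset.sum_image hinj, IsKickOrbit.add_sum hstep], ?_⟩
  intro ζ hζ
  obtain ⟨k, hk, rfl⟩ := Finset.mem_image.1 hζ
  rw [Finset.mem_range] at hk
  set w : ℕ → ℂ := fun i => (s (n + i) : ℂ) * μ ^ (n + i) with hw
  set b : ℂ := a * μ ^ n * (starRingEnd ℂ) (w k) with hb
  have hnb : ‖b‖ = ‖a‖ := by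
    have : ‖w k‖ = 1 := by
      rw [hw]; rcases hs (n + k) with h1 | h1 <;> simp [h1, hnμ]
    rw [hb]; simp [hnμ, this]
  have hbound := sum_abs_im_le hμ.pow_eq_one hμ2 hnμ b
  rw [hnb] at hbound
  have hterm : ∀ i, |(a * w i * (starRingEnd ℂ) (w k)).im| = |(b * μ ^ i).im| := by
    intro i
    have : a * w i * (starRingEnd ℂ) (w k) = (s (n + i) : ℂ) * (b * μ ^ i) := by
      simp only [hw, hb]; rw [pow_add μ n i]; ring
    rw [this, Complex.im_ofReal_mul, abs_mul]
    rcases hs (n + i) with h1 | h1 <;> simp [h1]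
  have hpart : ∀ S ⊆ Finset.range h,
      |((a * ∑ i ∈ S, w i) * (starRingEnd ℂ) (w k)).im| ≤ ‖a‖ * (h / √2) := by
    intro S hS
    rw [Finset.mul_sum, Finset.sum_mul, Complex.im_sum]
    refine (Finset.abs_sum_le_sum_abs _ _).trans (le_trans ?_ hbound)
    simp_rw [hterm]
    exact Finset.sum_le_sum_of_subset_of_nonneg hS fun _ _ _ => abs_nonneg _
  have hk0 : -δ ≤ (y (n + k) * (starRingEnd ℂ) (w k)).im := hside (n + k)
  have e1 : y (n + k) = y n + a * ∑ i ∈ Finset.range k, w i := IsKickOrbit.add_sum hstep n k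
  have e2 : y (n + h) = y (n + k) + a * ∑ i ∈ Finset.Ico k h, w i := by
    rw [IsKickOrbit.add_sum hstep n h, e1, ← Finset.sum_range_add_sum_Ico _ hk.le]; ring
  have p1 := hpart (Finset.range k) (Finset.range_subset_range.2 hk.le)
  have p2 := hpart (Finset.Ico k h) (fun i hi => by simp at hi ⊢; omega)
  constructor
  · rw [e1, add_mul, Complex.add_im] at hk0
    linarith [(abs_le.1 p1).2]
  · rw [e2, add_mul, Complex.add_im]
    linarith [(abs_le.1 p2).1]

lemma IsKickOrbit.norm_sub_le {μ a : ℂ} {δ : ℝ} {y : ℕ → ℂ} (hμ : ‖μ‖ = 1)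
    (hy : IsKickOrbit μ a δ y) (n k : ℕ) : ‖y (n + k) - y n‖ ≤ k * ‖a‖ := by
  obtain ⟨s, hs, hstep, -⟩ := hy
  induction k with
  | zero => simp
  | succ k ih =>
    have h1 : ‖y (n + k + 1) - y (n + k)‖ = ‖a‖ := by
      rw [hstep, add_sub_cancel_left]
      rcases hs (n + k) with h1 | h1 <;> simp [h1, hμ]
    calc ‖y (n + k + 1) - y n‖ ≤ ‖y (n + k + 1) - y (n + k)‖ + ‖y (n + k) - y n‖ :=
          norm_sub_le_norm_sub_add_norm_sub _ _ _
      _ ≤ _ := by rw [h1]; push_cast; linarith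

lemma angle_facts {h : ℕ} (hh : 2 ≤ h) {φ : ℝ} (hφ : φ = Real.pi / (2 * h)) :
    0 < Real.cos φ ∧ 0 < Real.sin φ := by
  have h2 : (2 : ℝ) ≤ h := by exact_mod_cast hh
  have hφ0 : 0 < φ := by rw [hφ]; positivity
  have hφh : 2 * φ * h = Real.pi := by rw [hφ]; field_simp
  have hφ4 : 2 * φ ≤ Real.pi / 2 := by nlinarith
  exact ⟨Real.cos_pos_of_mem_Ioo ⟨by linarith, by linarith⟩,
    Real.sin_pos_of_pos_of_lt_pi hφ0 (by linarith)⟩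

lemma IsKickOrbit.linear_escape {h : ℕ} (hh : 2 ≤ h) {μ κ : ℂ} (hμ : IsPrimitiveRoot μ (2 * h))
    {δ φ ε : ℝ} (hφ : φ = Real.pi / (2 * h)) (hδ : 0 ≤ δ) (hκ : 0 < κ.re)
    (hε : ε = δ + ‖κ‖ * (h / √2)) :
    ∃ c b : ℝ, 0 < c ∧ ∀ y : ℕ → ℂ, IsKickOrbit μ (κ * Complex.I) δ y →
      ε * (1 + |κ.im / κ.re| + Real.cos φ / Real.sin φ) < ‖y 0‖ → ∀ n : ℕ, c * n - b ≤ ‖y n‖ := by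
  have h0 : (0 : ℝ) < h := by positivity
  have hnμ : ‖μ‖ = 1 := Complex.norm_eq_one_of_pow_eq_one hμ.pow_eq_one (by omega)
  have hε0 : 0 ≤ ε := by rw [hε]; positivity
  have hna : ‖κ * Complex.I‖ = ‖κ‖ := by simp
  obtain ⟨hc, -⟩ := angle_facts hh hφ
  obtain ⟨N, η, hη, hN, hgrow⟩ := exists_lyapunov hh hφ hε0 hκ
  refine ⟨η / h, η + h * ‖κ‖, by positivity, fun y hy hy0 n => ?_⟩
  -- The factor `cos φ` is the one lost in comparing the gauge with the norm, so it cancels.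
  set ρ := ε * Real.cos φ * (1 + |κ.im / κ.re| + Real.cos φ / Real.sin φ) with hρ
  have hN0 : ρ < N (y 0) := by
    refine lt_of_lt_of_le ?_ (hN (y 0)).1
    have := mul_lt_mul_of_pos_left hy0 hc
    rw [hρ]; linarith
  have hiter : ∀ j : ℕ, N (y 0) + j * η ≤ N (y (j * h)) := by
    intro j
    induction j with
    | zero => simp
    | succ j ih =>
      obtain ⟨A, hA, hstep, hside⟩ := hy.block hh hμ (j * h)
      have hj : (0 : ℝ) ≤ j * η := by positivity
      have := hgrow A (y (j * h)) hA (fun ζ hζ => by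
        rw [hε, ← hna]; exact (hside ζ hζ).1) (by linarith)
      rw [← hstep, ← Nat.succ_mul] at this
      push_cast; linarith
  have hρ0 : 0 ≤ ρ := by
    have := (angle_facts hh hφ).2
    positivity
  have h1 := hiter (n / h)
  have h2 := (hN (y (n / h * h))).2
  have h3 := hy.norm_sub_le hnμ (n / h * h) (n % h)
  rw [Nat.div_add_mod', hna] at h3
  have h4 : ((n % h : ℕ) : ℝ) * ‖κ‖ ≤ h * ‖κ‖ := by
    gcongr; exact_mod_cast (Nat.mod_lt n (by omega)).le
  have h5 : ‖y (n / h * h)‖ ≤ ‖y n‖ + ‖y n - y (n / h * h)‖ := by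
    have := norm_sub_norm_le (y (n / h * h)) (y n)
    rw [norm_sub_rev] at this; linarith
  have h6 : η / h * n ≤ (n / h : ℕ) * η + η := by
    have : (n : ℝ) ≤ h * ((n / h : ℕ) + 1) := by
      exact_mod_cast (Nat.lt_mul_div_succ n (by omega)).le
    calc η / h * n ≤ η / h * (h * ((n / h : ℕ) + 1)) := by gcongr
      _ = _ := by field_simp
  linarith

lemma IsKickOrbit.eventually_norm_le {h : ℕ} (hh : 2 ≤ h) {μ κ : ℂ}
    (hμ : IsPrimitiveRoot μ (2 * h)) {δ φ ε : ℝ} (hφ : φ = Real.pi / (2 * h)) (hδ : 0 ≤ δ)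
    (hκ : κ.re < 0) (hε : ε = δ + ‖κ‖ * (h / √2)) (Q : ℝ) :
    ∃ n₀ : ℕ, ∀ y : ℕ → ℂ, IsKickOrbit μ (κ * Complex.I) δ y → ‖y 0‖ ≤ Q →
      ∀ n ≥ n₀, ‖y n‖ ≤ ε * (1 + |κ.im / κ.re| + Real.cos φ / Real.sin φ) := by
  have h0 : (0 : ℝ) < h := by positivity
  have hnμ : ‖μ‖ = 1 := Complex.norm_eq_one_of_pow_eq_one hμ.pow_eq_one (by omega)
  have hε0 : 0 ≤ ε := by rw [hε]; positivity
  have hna : ‖κ * Complex.I‖ = ‖κ‖ := by simp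
  obtain ⟨hc, hsφ⟩ := angle_facts hh hφ
  obtain ⟨N, η, hη, hN, hgrow⟩ := exists_lyapunov (κ := -κ) hh hφ hε0 (by simpa using hκ)
  simp only [Complex.neg_im, Complex.neg_re, neg_div_neg_eq] at hgrow
  set ρ := ε * Real.cos φ * (1 + |κ.im / κ.re| + Real.cos φ / Real.sin φ) with hρ
  have hρ0 : 0 ≤ ρ := by positivity
  obtain ⟨J, hJ⟩ := exists_nat_ge ((Q + h * ‖κ‖) / η)
  refine ⟨(J + 1) * h, fun y hy hy0 n hn => ?_⟩
  -- Each residue class modulo `h` is followed separately, so the final bound holds at all times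
  -- without a loss inside a block.
  have hiter : ∀ r < h, ∀ j : ℕ, N (y (r + j * h)) ≤ max ρ (Q + h * ‖κ‖ - j * η) := by
    intro r hr j
    induction j with
    | zero =>
      refine le_max_of_le_right ?_
      have h3 := hy.norm_sub_le hnμ 0 r
      rw [zero_add, hna] at h3
      have h4 : (r : ℝ) * ‖κ‖ ≤ h * ‖κ‖ := by gcongr
      have h5 := norm_sub_norm_le (y r) (y 0)
      have h6 := (hN (y r)).2
      simp only [zero_mul, add_zero, Nat.cast_zero, sub_zero]
      linarith
    | succ j ih =>
      obtain ⟨A, hA, hstep, hside⟩ := hy.block hh hμ (r + j * h)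
      rw [show r + (j + 1) * h = r + j * h + h by ring]
      rcases le_or_gt (N (y (r + j * h + h))) ρ with h1 | h1
      · exact le_max_of_le_left h1
      -- Time reversal: from the end of the block, the drift `-κ` leads back to its start, where the
      -- gauge is larger by `η`.
      · have := hgrow A _ hA (fun ζ hζ => by
          rw [hε, ← hna]; exact (hside ζ hζ).2) h1
        have hback : y (r + j * h + h) + -κ * Complex.I * ∑ ζ ∈ A, ζ = y (r + j * h) := by
          rw [hstep]; ring
        rw [hback] at this
        rcases le_max_iff.1 ih with h2 | h2
        · linarith
        · refine le_max_of_le_right ?_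
          push_cast; linarith
  have hmain := hiter (n % h) (Nat.mod_lt n (by omega)) (n / h)
  rw [Nat.mod_add_div'] at hmain
  have hJn : (J : ℝ) ≤ (n / h : ℕ) := by
    have : J + 1 ≤ n / h := (Nat.le_div_iff_mul_le (by omega)).2 hn
    exact_mod_cast (Nat.le_succ J).trans this
  have hneg : Q + h * ‖κ‖ - (n / h : ℕ) * η ≤ ρ := by
    rw [div_le_iff₀ hη] at hJ
    have : (J : ℝ) * η ≤ (n / h : ℕ) * η := by gcongr
    linarith
  rw [max_eq_left hneg] at hmain
  have := (hN (y n)).1.trans hmain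
  refine le_of_mul_le_mul_left (this.trans (le_of_eq ?_)) hc
  rw [hρ]; ring


/-! ### The piecewise rotation as a kick orbit. -/

open Complex in
lemma mem_halfPlane₀_iff {z₀ : ℂ} {γ : ℝ} (h0 : (0 : ℂ) ∈ line z₀ γ) (z : ℂ) :
    z ∈ halfPlane₀ z₀ γ ↔ 0 < (z * exp (-(γ * I))).im := by
  obtain ⟨t, ht⟩ := h0
  have hz : z₀ * exp (-(γ * I)) = (-t : ℝ) := by
    have h1 : exp (γ * I) * exp (-(γ * I)) = 1 := by rw [← exp_add]; simp
    push_cast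
    linear_combination (-exp (-(γ * I))) * ht - t * h1
  rw [halfPlane₀, Set.mem_ofPred_eq, sub_mul, hz, sub_im, ofReal_im, sub_zero]

/-- `1` on the half-plane `𝐏₀` (for a line through `0`, with `G = e^{-iγ}`), `-1` off it. -/
noncomputable def side (G z : ℂ) : ℝ := if 0 < (z * G).im then 1 else -1

lemma side_eq (G z : ℂ) : side G z = 1 ∨ side G z = -1 := by
  unfold side; split_ifs <;> simp

open Complex in
lemma pieceRot_eq {α γ : ℝ} {C₀ C₁ z₀ : ℂ} (h0 : (0 : ℂ) ∈ line z₀ γ) (z : ℂ) :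
    pieceRot α C₀ C₁ z₀ γ z = exp (α * I) * (z - (C₀ + C₁) / 2) + (C₀ + C₁) / 2
      + side (exp (-(γ * I))) z * ((C₀ - C₁) / 2 * (1 - exp (α * I))) := by
  unfold pieceRot rot side
  rw [mem_halfPlane₀_iff h0]
  split_ifs <;> push_cast <;> ring

open Complex in
lemma tripleNorm_ne_top {α γ : ℝ} {C₀ C₁ z₀ : ℂ} :
    tripleNorm (pieceRot α C₀ C₁ z₀ γ) ≠ ⊤ := by
  refine ne_top_of_le_ne_top (b := ENNReal.ofReal
    (‖C₀ * (1 - exp (α * I))‖ + ‖C₁ * (1 - exp (α * I))‖)) ENNReal.ofReal_ne_top ?_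
  refine iSup_le fun z => ENNReal.ofReal_le_ofReal ?_
  have key : ∀ C : ℂ, |‖rot α C z‖ - ‖z‖| ≤ ‖C * (1 - exp (α * I))‖ := by
    intro C
    have h1 : ‖z‖ = ‖exp (α * I) * z‖ := by rw [norm_mul, norm_exp_ofReal_mul_I, one_mul]
    rw [h1]
    refine (abs_norm_sub_norm_le _ _).trans (le_of_eq ?_)
    congr 1; unfold rot; ring
  unfold pieceRot
  split_ifs
  · linarith [key C₀, norm_nonneg (C₁ * (1 - exp (α * I)))]
  · linarith [key C₁, norm_nonneg (C₀ * (1 - exp (α * I)))]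

lemma abs_norm_sub_le_tripleNorm {T : ℂ → ℂ} (hT : tripleNorm T ≠ ⊤) (z : ℂ) :
    |‖T z‖ - ‖z‖| ≤ (tripleNorm T).toReal :=
  (ENNReal.ofReal_le_iff_le_toReal hT).1
    (le_iSup (fun z : ℂ => ENNReal.ofReal |‖T z‖ - ‖z‖|) z)

open Complex in
lemma norm_translation_le_tripleNorm {α γ : ℝ} {C₀ C₁ z₀ : ℂ} (h0 : (0 : ℂ) ∈ line z₀ γ) :
    ‖C₀ * (1 - exp (α * I))‖ ≤ (tripleNorm (pieceRot α C₀ C₁ z₀ γ)).toReal ∧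
      ‖C₁ * (1 - exp (α * I))‖ ≤ (tripleNorm (pieceRot α C₀ C₁ z₀ γ)).toReal := by
  have hle := abs_norm_sub_le_tripleNorm (tripleNorm_ne_top (α := α) (C₀ := C₀) (C₁ := C₁)
    (z₀ := z₀) (γ := γ))
  constructor
  · refine le_of_forall_pos_le_add fun ε hε => ?_
    -- The origin lies in `𝐏₁`, so the translation for `C₀` is only seen in the limit from inside
    -- `𝐏₀`.
    set z : ℂ := (ε / 2 : ℝ) * I * exp (γ * I) with hz
    have hnz : ‖z‖ = ε / 2 := by
      rw [hz, norm_mul, norm_mul, norm_exp_ofReal_mul_I, norm_I, norm_real, Real.norm_eq_abs,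
        abs_of_pos (by positivity)]; ring
    have hmem : z ∈ halfPlane₀ z₀ γ := by
      rw [mem_halfPlane₀_iff h0, hz, mul_assoc, ← exp_add]
      simp; positivity
    have h1 := (le_abs_self _).trans (hle z)
    have h2 : pieceRot α C₀ C₁ z₀ γ z = rot α C₀ z := by rw [pieceRot, if_pos hmem]
    rw [h2, hnz] at h1
    have h3 : C₀ * (1 - exp (α * I)) = rot α C₀ z - exp (α * I) * z := by unfold rot; ring
    have h4 : ‖exp (α * I) * z‖ = ε / 2 := by rw [norm_mul, norm_exp_ofReal_mul_I, hnz, one_mul]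
    rw [h3]
    linarith [norm_sub_le (rot α C₀ z) (exp (α * I) * z)]
  · have hmem : (0 : ℂ) ∉ halfPlane₀ z₀ γ := by rw [mem_halfPlane₀_iff h0]; simp
    have h1 := (le_abs_self _).trans (hle 0)
    rw [pieceRot, if_neg hmem, norm_zero, sub_zero] at h1
    refine le_trans (le_of_eq ?_) h1
    congr 1; unfold rot; ring

lemma side_eq_of_im_eq {G z w : ℂ} (h : (z * G).im = (w * G).im) : side G z = side G w := by
  unfold side; rw [h]

/-- Such a `T` slides each half-plane along the boundary line, hence onto itself, and then rotates.
-/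
lemma bijective_of_shift_parallel {T : ℂ → ℂ} {G l f d : ℂ} (hl : l ≠ 0)
    (hT : ∀ z, T z = l * (z - f) + f + side G z * d) (hd : (l⁻¹ * d * G).im = 0) :
    Function.Bijective T := by
  have him : ∀ (z : ℂ) (r : ℝ), ((z + r * (l⁻¹ * d)) * G).im = (z * G).im := by
    intro z r
    rw [add_mul, mul_assoc (r : ℂ), Complex.add_im, Complex.im_ofReal_mul, hd]; ring
  constructor
  · intro z w hzw
    rw [hT, hT] at hzw
    have h1 : z + side G z * (l⁻¹ * d) = w + side G w * (l⁻¹ * d) := by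
      field_simp; linear_combination hzw
    have h2 : side G z = side G w := by
      apply side_eq_of_im_eq
      rw [← him z (side G z), h1, him]
    rw [h2] at h1
    exact add_right_cancel h1
  · intro w
    set v := l⁻¹ * (w - f) + f with hv
    refine ⟨v + ((-side G v : ℝ) : ℂ) * (l⁻¹ * d), ?_⟩
    rw [hT, side_eq_of_im_eq (him v (-side G v))]
    rw [hv]; push_cast; field_simp; ring

/-- The tolerance `‖f‖` arises because sides are taken with respect to a line through `0`, while the
orbit is centred at `f`. -/
lemma isKickOrbit_iterate {T : ℂ → ℂ} {G l f d : ℂ} (hl : ‖l‖ = 1) (hG : ‖G‖ = 1)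
    (hT : ∀ z, T z = l * (z - f) + f + side G z * d) (z : ℂ) :
    IsKickOrbit l⁻¹ (l⁻¹ * d * G) ‖f‖ (fun n => G * l⁻¹ ^ n * (T^[n] z - f)) := by
  have hl0 : l ≠ 0 := by rintro rfl; simp at hl
  refine ⟨fun n => side G (T^[n] z), fun n => side_eq _ _, fun n => ?_, fun n => ?_⟩
  · simp only
    rw [Function.iterate_succ_apply', hT, pow_succ]
    field_simp
    ring
  · set w := T^[n] z
    have h1 : l⁻¹ ^ n * (starRingEnd ℂ) (l⁻¹ ^ n) = 1 := by
      rw [Complex.mul_conj, Complex.normSq_eq_norm_sq]; simp [hl]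
    have h2 : G * l⁻¹ ^ n * (w - f) * (starRingEnd ℂ) (side G w * l⁻¹ ^ n)
        = (side G w : ℂ) * (w * G - G * f) := by
      rw [map_mul, Complex.conj_ofReal]
      linear_combination (G * (w - f) * side G w) * h1
    simp only
    rw [h2, Complex.im_ofReal_mul, Complex.sub_im]
    have h3 : |(G * f).im| ≤ ‖f‖ := (Complex.abs_im_le_norm _).trans (by rw [norm_mul, hG, one_mul])
    have h4 := abs_le.1 h3
    unfold side
    split_ifs with h5 <;> linarith

open Complex in
lemma drift_eq (α β γ : ℝ) (C₀ C₁ : ℂ) (hβ : β = arg (C₁ - C₀)) :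
    (exp (α * I))⁻¹ * ((C₀ - C₁) / 2 * (1 - exp (α * I))) * exp (-(γ * I))
      = ((Real.sin (α / 2) * ‖C₁ - C₀‖ : ℝ) * exp ((β - α / 2 - γ : ℝ) * I)) * I := by
  have h1 : C₁ - C₀ = ‖C₁ - C₀‖ * exp (β * I) := by rw [hβ, norm_mul_exp_arg_mul_I]
  have h2 : C₀ - C₁ = -(‖C₁ - C₀‖ * exp (β * I)) := by rw [← h1]; ring
  have h3 : ((Real.sin (α / 2) : ℝ) : ℂ) = (exp (-(α / 2 * I)) - exp (α / 2 * I)) * I / 2 := by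
    push_cast; rw [Complex.sin]; ring_nf
  have h4 : exp ((β - α / 2 - γ : ℝ) * I) = exp (β * I) * exp (-(α / 2 * I)) * exp (-(γ * I)) := by
    rw [← exp_add, ← exp_add]; congr 1; push_cast; ring
  have h5 : exp (α * I) = exp (α / 2 * I) ^ 2 := by
    rw [← exp_nat_mul]; congr 1; push_cast; ring
  rw [ofReal_mul, h3, h4, h2, h5, exp_neg (α / 2 * I)]
  have := exp_ne_zero (α / 2 * I)
  field_simp
  rw [I_sq]
  ring

/-! ### The explicit radius and the conclusion. -/

/-- Here `m = ‖f (1 - l)‖`. As `1/4 + 0.71² < 1`, the tolerance `f + d h/√2` is at most `h R`;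
recentring from `f` to `0` costs another `h R / 2`. The strict inequality is needed for repulsion
from the closed exterior. -/
lemma budget {h R m d f x t : ℝ} (hh : 0 < h) (hm : 0 ≤ m) (hd : 0 ≤ d) (hR : 0 < R)
    (hf : f ≤ h / 2 * m) (hmd : m ^ 2 + d ^ 2 ≤ R ^ 2) (ht : 0 ≤ t) (hx : 0 ≤ x) :
    f + (f + d * (h / √2)) * (1 + t + x) < h * R * (t + x + 2) := by
  have hmR : m ≤ R := by nlinarith
  have h2 : 1 / √2 ≤ 0.71 := by
    rw [div_le_iff₀ (by positivity)]
    have : 1.41 ≤ √2 := Real.le_sqrt_of_sq_le (by norm_num)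
    linarith
  have h3 : m / 2 + 0.71 * d ≤ R := by
    apply abs_le_of_sq_le_sq' _ hR.le |>.2
    nlinarith [sq_nonneg (0.71 * m - d / 2)]
  have h4 : f + d * (h / √2) ≤ h * R := by
    have : d * (h / √2) ≤ d * h * 0.71 := by
      rw [show d * (h / √2) = d * h * (1 / √2) by ring]; gcongr
    nlinarith
  have h5 : f ≤ h * R / 2 := by nlinarith
  have h6 : (f + d * (h / √2)) * (1 + t + x) ≤ h * R * (1 + t + x) := by gcongr
  have : 0 < h * R := by positivity
  nlinarith

lemma repelsWith_of_linear {T : ℂ → ℂ} {B c b : ℝ} (hc : 0 < c)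
    (h : ∀ z, B ≤ ‖z‖ → ∀ n : ℕ, c * n - b ≤ ‖T^[n] z‖) : RepelsWith T B := by
  intro L hL
  apply Tendsto.liminf_eq
  have h1 : Tendsto (fun n : ℕ => c * (n : ℝ) - b) atTop atTop :=
    tendsto_atTop_add_const_right _ _ (tendsto_natCast_atTop_atTop.const_mul_atTop hc)
  refine tendsto_nhds_top_mono' (ENNReal.tendsto_ofReal_nhds_top.2 h1) fun n => ?_
  refine le_iInf fun z => le_iInf fun hz => ?_
  rw [← ofReal_norm]
  exact ENNReal.ofReal_le_ofReal (h z (hL.trans hz) n)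

lemma attractsWith_of_eventually {T : ℂ → ℂ} {B : ℝ}
    (h : ∀ L : ℝ, ∃ n₀ : ℕ, ∀ z, ‖z‖ ≤ L → ∀ n ≥ n₀, ‖T^[n] z‖ ≤ B) : AttractsWith T B := by
  intro L _
  obtain ⟨n₀, hn₀⟩ := h L
  refine limsup_le_of_le (by isBoundedDefault) ?_
  filter_upwards [eventually_ge_atTop n₀] with n hn
  refine iSup_le fun z => iSup_le fun hz => ?_
  rw [← ofReal_norm]
  exact ENNReal.ofReal_le_ofReal (hn₀ z hz n hn)

lemma limitRadius_le {T : ℂ → ℂ} {B : ℝ} (hB : 0 ≤ B) (h : AttractsWith T B ∨ RepelsWith T B) :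
    (GloballyAttractive T ∨ GloballyRepulsive T) ∧ limitRadius T ≤ B :=
  ⟨h.imp (fun h => ⟨B, hB, h⟩) (fun h => ⟨B, hB, h⟩), csInf_le ⟨0, fun _ hM => hM.1⟩ ⟨hB, h⟩⟩

lemma isPrimitiveRoot_exp_of_isCoprime {p : ℤ} {q : ℕ} (hq : q ≠ 0) (hpq : IsCoprime p (q : ℤ))
    {α : ℝ} (hα : α = (p : ℝ) / (q : ℝ) * (2 * Real.pi)) :
    IsPrimitiveRoot (Complex.exp (α * Complex.I)) q := by
  have h1 := (Complex.isPrimitiveRoot_exp q hq).zpow_of_gcd_eq_one p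
    (Int.isCoprime_iff_gcd_eq_one.1 hpq)
  rw [← Complex.exp_int_mul] at h1
  have h2 : (α : ℂ) * Complex.I = p * (2 * Real.pi * Complex.I / q) := by
    rw [hα]; push_cast; ring
  rwa [h2]

/-- A system of two rotations conjugated by `l` of order `2h`, with drift `κ`, attracts or repels
everything outside an explicit radius. -/
lemma attracts_or_repels {T : ℂ → ℂ} {G l f d κ : ℂ} {h : ℕ} {φ R : ℝ} (hh : 2 ≤ h)
    (hφ : φ = Real.pi / (2 * h)) (hl : IsPrimitiveRoot l (2 * h)) (hG : ‖G‖ = 1)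
    (hT : ∀ z, T z = l * (z - f) + f + side G z * d) (hκ : l⁻¹ * d * G = κ * Complex.I)
    (hκ0 : κ.re ≠ 0) (hR0 : ‖f * (1 - l) + d‖ ≤ R) (hR1 : ‖f * (1 - l) - d‖ ≤ R) :
    0 ≤ R ∧ (AttractsWith T (h * R * (|κ.im / κ.re| + Real.cos φ / Real.sin φ + 2)) ∨
      RepelsWith T (h * R * (|κ.im / κ.re| + Real.cos φ / Real.sin φ + 2))) := by
  have h0 : (0 : ℝ) < h := by positivity
  obtain ⟨hc, hs⟩ := angle_facts hh hφ
  have hnl : ‖l‖ = 1 := Complex.norm_eq_one_of_pow_eq_one hl.pow_eq_one (by omega)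
  have hμ : IsPrimitiveRoot l⁻¹ (2 * h) := hl.inv
  have hdκ : ‖d‖ = ‖κ‖ := by
    have := congrArg norm hκ
    simpa [hnl, hG] using this
  have hκpos : 0 < ‖κ‖ := norm_pos_iff.2 fun hk => hκ0 (by rw [hk]; rfl)
  -- The vectors `f (1 - l) ± d` are the translation parts of the two rotations.
  have hpar := parallelogram_law_with_norm ℝ (f * (1 - l)) d
  have hmd : ‖f * (1 - l)‖ ^ 2 + ‖d‖ ^ 2 ≤ R ^ 2 := by
    nlinarith [norm_nonneg (f * (1 - l) + d), norm_nonneg (f * (1 - l) - d)]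
  have hRnn : 0 ≤ R := (norm_nonneg _).trans hR0
  have hR : 0 < R := by
    rcases hRnn.lt_or_eq with h1 | h1
    · exact h1
    · rw [← h1, hdκ] at hmd; nlinarith [sq_nonneg ‖f * (1 - l)‖]
  have hlh : l ^ h = -1 := by
    have h1 : (l ^ h) ^ 2 = 1 := by rw [← pow_mul, mul_comm, hl.pow_eq_one]
    rcases sq_eq_sq_iff_eq_or_eq_neg.1 (h1.trans (one_pow 2).symm) with h2 | h2
    · have := Nat.le_of_dvd (by omega) (hl.dvd_of_pow_eq_one _ h2); omega
    · exact h2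
  have hf : ‖f‖ ≤ h / 2 * ‖f * (1 - l)‖ := by
    have h1 := geom_sum_mul l h
    have h2 : f = (∑ i ∈ Finset.range h, l ^ i) / 2 * (f * (1 - l)) := by
      rw [hlh] at h1; linear_combination (f / 2) * h1
    have h3 : ‖∑ i ∈ Finset.range h, l ^ i‖ ≤ h := by
      refine (norm_sum_le _ _).trans ?_
      simp [hnl]
    calc ‖f‖ = ‖∑ i ∈ Finset.range h, l ^ i‖ / 2 * ‖f * (1 - l)‖ := by
          conv_lhs => rw [h2]
          simp
      _ ≤ _ := by gcongr
  have hbud := budget h0 (norm_nonneg _) (norm_nonneg _) hR hf hmd (abs_nonneg (κ.im / κ.re))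
    (div_pos hc hs).le
  rw [hdκ] at hbud
  refine ⟨hRnn, ?_⟩
  have horb : ∀ z, IsKickOrbit l⁻¹ (κ * Complex.I) ‖f‖ (fun n => G * l⁻¹ ^ n * (T^[n] z - f)) :=
    fun z => hκ ▸ isKickOrbit_iterate hnl hG hT z
  have hnorm : ∀ z (n : ℕ), ‖G * l⁻¹ ^ n * (T^[n] z - f)‖ = ‖T^[n] z - f‖ := by
    intro z n; simp [hG, hnl]
  rcases lt_or_gt_of_ne hκ0 with hneg | hpos
  · left
    refine attractsWith_of_eventually fun L => ?_
    obtain ⟨n₀, hn₀⟩ := IsKickOrbit.eventually_norm_le hh hμ hφ (norm_nonneg f) hneg rfl (L + ‖f‖)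
    refine ⟨n₀, fun z hz n hn => ?_⟩
    have h1 := hn₀ _ (horb z) (by
      rw [hnorm z 0]; exact (norm_sub_le _ _).trans (by simpa using hz)) n hn
    rw [hnorm] at h1
    linarith [norm_sub_norm_le (T^[n] z) f]
  · right
    obtain ⟨c, b, hc', hesc⟩ := IsKickOrbit.linear_escape hh hμ hφ (norm_nonneg f) hpos rfl
    refine repelsWith_of_linear (b := b + ‖f‖) hc' fun z hz n => ?_
    have h1 := hesc _ (horb z) (by
      rw [hnorm z 0]
      have := norm_sub_norm_le z f
      simp only [Function.iterate_zero, id_eq]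
      linarith) n
    rw [hnorm] at h1
    linarith [norm_sub_le (T^[n] z) f]

end PiecewiseRotation

theorem mainTheorem2
    (p : ℤ) (q : ℕ) (hq : 2 < q) (hqe : Even q) (hpq : IsCoprime p (q : ℤ))
    (α : ℝ) (hα : α = (p : ℝ) / (q : ℝ) * (2 * Real.pi))
    (C₀ C₁ z₀ : ℂ) (γ : ℝ)
    (h0 : (0 : ℂ) ∈ PiecewiseRotation.line z₀ γ)
    (β : ℝ) (hβ : β = Complex.arg (C₁ - C₀))
    (T : ℂ → ℂ) (hT : T = PiecewiseRotation.pieceRot α C₀ C₁ z₀ γ)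
    (hbij : ¬ Function.Bijective T) :
    PiecewiseRotation.tripleNorm T ≠ ⊤ ∧
    (PiecewiseRotation.GloballyAttractive T ∨ PiecewiseRotation.GloballyRepulsive T) ∧
    PiecewiseRotation.limitRadius T ≤
      (q : ℝ) * (PiecewiseRotation.tripleNorm T).toReal *
        (1 / (2 * |Real.tan (β - α / 2 - γ + Real.pi / 2)|)
          + 1 / (2 * Real.tan (Real.pi / (q : ℝ))) + 1) := by
  open PiecewiseRotation in
  refine ⟨hT ▸ tripleNorm_ne_top, ?_⟩
  obtain ⟨h, rfl⟩ := hqe.two_dvd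
  have hh : 2 ≤ h := by omega
  have hl := isPrimitiveRoot_exp_of_isCoprime (by omega) hpq hα
  have hTz := fun z => pieceRot_eq (α := α) (C₀ := C₀) (C₁ := C₁) h0 z
  rw [← hT] at hTz
  have hdrift := drift_eq α β γ C₀ C₁ hβ
  set θ := β - α / 2 - γ with hθ
  set r := Real.sin (α / 2) * ‖C₁ - C₀‖ with hr
  set κ : ℂ := r * Complex.exp (θ * Complex.I) with hκ
  have hre : κ.re = r * Real.cos θ := by
    rw [hκ, Complex.re_ofReal_mul, Complex.exp_ofReal_mul_I_re]
  have him : κ.im = r * Real.sin θ := by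
    rw [hκ, Complex.im_ofReal_mul, Complex.exp_ofReal_mul_I_im]
  have hκ0 : κ.re ≠ 0 := fun hk =>
    hbij (bijective_of_shift_parallel (Complex.exp_ne_zero _) hTz (by rw [hdrift]; simpa using hk))
  obtain ⟨hR0, hR1⟩ := norm_translation_le_tripleNorm (α := α) (C₀ := C₀) (C₁ := C₁) h0
  rw [← hT] at hR0 hR1
  set R := (tripleNorm T).toReal
  have hG : ‖Complex.exp (-(γ * Complex.I))‖ = 1 := by
    rw [Complex.norm_exp]; simp
  set φ := Real.pi / (2 * (h : ℝ)) with hφ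
  obtain ⟨hR, hmain⟩ := attracts_or_repels (R := R) hh hφ hl hG hTz hdrift hκ0
    (by convert hR0 using 2; ring) (by convert hR1 using 2; ring)
  have hB : (h : ℝ) * R * (|κ.im / κ.re| + Real.cos φ / Real.sin φ + 2)
      = ((2 * h : ℕ) : ℝ) * R * (1 / (2 * |Real.tan (θ + Real.pi / 2)|)
          + 1 / (2 * Real.tan (Real.pi / ((2 * h : ℕ) : ℝ))) + 1) := by
    have hr0 : r ≠ 0 := fun h1 => hκ0 (by rw [hre, h1, zero_mul])
    -- If `sin θ = 0`, division by zero gives the tangent the value `0` and its inverse the value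
    -- `0`, which agrees with `|tan θ| = 0`.
    rw [hre, him, mul_div_mul_left _ _ hr0, Real.tan_eq_sin_div_cos (θ + _), Real.sin_add_pi_div_two,
      Real.cos_add_pi_div_two, div_neg, abs_neg, Nat.cast_mul, Nat.cast_ofNat, ← hφ,
      Real.tan_eq_sin_div_cos, one_div, mul_inv, ← abs_inv, inv_div, one_div, mul_inv, inv_div]
    ring
  obtain ⟨hc, hs⟩ := angle_facts hh hφ
  rw [← hB]
  exact limitRadius_le (by positivity) hmain
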